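/- Let $G$ be a locally compact (Hausdorff) group with left Haar measure $dx$, let $L_1(G)$ be the complex Banach space of integrable functions with convolution $(f*g)(x)=\int_G f(t)\,g(t^{-1}x)\,dt$, and let $L_\infty(G)=L_1(G)^*$ with its usual pairing $\langle T,f\rangle=\int_G T(x)f(x)\,dx$, order and unit $1$. Put $P_1(G)=\{f\in L_1(G): f\ge 0,\ \|f\|_1=1\}$. A mean is a positive functional $m\in L_\infty(G)^*$ with $m(1)=1$. For $f\in L_1(G)$ and $T\in L_\infty(G)$ define $fT,\,Tf\in L_\infty(G)$ by $\langle fT,g\rangle=\langle T,f*g\rangle$ and $\langle Tf,g\rangle=\langle T,g*f\rangle$ for $g\in L_1(G)$. A mean $m$ is topologically left invariant if $m(fT)=m(T)$, and topologically right invariant if $m(Tf)=m(T)$, for all $f\in P_1(G)$ and $T\in L_\infty(G)$; it is topologically two-sided invariant if it is both. A net $(f_\gamma)$ in $P_1(G)$ is a left TI-net if $\|g*f_\gamma-f_\gamma\|_1\to 0$ for every $g\in P_1(G)$, a right TI-net if $\|f_\gamma*g-f_\gamma\|_1\to 0$ for every $g\in P_1(G)$, and a two-sided TI-net if it is both. Then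 every topologically left invariant mean on $L_\infty(G)$ is the weak* limit of a left TI-net, that is, there is a left TI-net $(f_\gamma)$ with $\langle T,f_\gamma\rangle\to m(T)$ for every $T\in L_\infty(G)$. Likewise, every topologically right invariant mean is the weak* limit of a right TI-net, and every topologically two-sided invariant mean is the weak* limit of a two-sided TI-net. -/

import Mathlib

open MeasureTheory Filter Topology
open scoped ENNReal ComplexOrder

universe u

set_option linter.unusedSectionVars false

noncomputable section

namespace TopInvMean

section Basic

variable {G : Type*} [MeasurableSpace G] (μ : Measure G)

/-- `L_1(G)`: complex integrable functions modulo equality almost everywhere. -/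
abbrev LOne : Type _ := Lp ℂ 1 μ

/-- `L_∞(G)`, as the dual Banach space of its predual `L_1(G)`, with the pairing
`⟨T, f⟩ = T f = ∫ T(x) f(x) dx`. When Haar measure is not `σ`-finite this is the usual `L_∞(G)`
(bounded locally measurable functions modulo locally null sets), which differs from the space
of bounded measurable functions modulo null sets. -/
abbrev LInfty : Type _ := StrongDual ℂ (LOne μ)

variable {μ}

/-- `f ≥ 0` almost everywhere. -/
def LOne.IsNonneg (f : LOne μ) : Prop := ∀ᵐ x ∂μ, (0 : ℂ) ≤ f x

/-- `T ≥ 0` in `L_∞(G)`: its integral against every nonnegative `f` in `L_1(G)` is nonnegative. -/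
def LInfty.IsNonneg (T : LInfty μ) : Prop := ∀ f : LOne μ, f.IsNonneg → (0 : ℂ) ≤ T f

variable (μ)

/-- `P_1(G)`: the nonnegative functions of norm one in `L_1(G)`. -/
def P1 : Set (LOne μ) := {f | f.IsNonneg ∧ ‖f‖ = 1}

/-- The constant function `1` in `L_∞(G)`, whose pairing with `f` is `∫ f`. -/
def LInfty.unit : LInfty μ := L1.integralCLM' ℂ

theorem LInfty.unit_apply (f : LOne μ) : LInfty.unit μ f = ∫ x, f x ∂μ := by
  rw [← L1.integral_eq_integral, L1.integral_eq' ℂ, LInfty.unit]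

variable {μ}

/-- A mean on `L_∞(G)`: a state, that is, a positive unital functional. -/
structure IsMean (m : StrongDual ℂ (LInfty μ)) : Prop where
  nonneg : ∀ T : LInfty μ, T.IsNonneg → (0 : ℂ) ≤ m T
  map_unit : m (LInfty.unit μ) = 1

/-- Weak* convergence of a net in `L_1(G)`, canonically embedded in `L_∞(G)^*`, to `m`. -/
def WeakStarTendsto {Γ : Type*} [Preorder Γ] (f : Γ → LOne μ) (m : StrongDual ℂ (LInfty μ)) :
    Prop :=
  ∀ T : LInfty μ, Tendsto (fun γ => T (f γ)) atTop (𝓝 (m T))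

end Basic

section Convolution

variable {G : Type*} [Group G] [TopologicalSpace G] [IsTopologicalGroup G] [LocallyCompactSpace G]
  [T2Space G] [MeasurableSpace G] [BorelSpace G] {μ : Measure G} [μ.IsHaarMeasure] [μ.Regular]

/-- Left translation `(l_t f)(x) = f(t⁻¹ x)` on `L_1(G)`. -/
def leftTranslate (t : G) (f : LOne μ) : LOne μ :=
  Lp.compMeasurePreserving (fun x => t⁻¹ * x) (measurePreserving_mul_left μ t⁻¹) f

theorem norm_leftTranslate (t : G) (f : LOne μ) : ‖leftTranslate t f‖ = ‖f‖ :=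
  Lp.norm_compMeasurePreserving _ _

theorem leftTranslate_add (t : G) (f g : LOne μ) :
    leftTranslate t (f + g) = leftTranslate t f + leftTranslate t g :=
  map_add (Lp.compMeasurePreserving _ (measurePreserving_mul_left μ t⁻¹)) f g

theorem leftTranslate_smul (t : G) (c : ℂ) (f : LOne μ) :
    leftTranslate t (c • f) = c • leftTranslate t f :=
  map_smul (Lp.compMeasurePreservingₗ ℂ _ (measurePreserving_mul_left μ t⁻¹)) c f

theorem continuous_leftTranslate (f : LOne μ) : Continuous fun t : G => leftTranslate t f := by
  have hg : Continuous fun t : G => (⟨fun x => t⁻¹ * x, by fun_prop⟩ : C(G, G)) :=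
    ContinuousMap.continuous_of_continuous_uncurry _ (by
      change Continuous fun p : G × G => p.1⁻¹ * p.2
      fun_prop)
  exact (continuous_const (y := f)).compMeasurePreservingLp hg
    (fun t => measurePreserving_mul_left μ t⁻¹) ENNReal.one_ne_top

theorem aestronglyMeasurable_leftTranslate_restrict (g : LOne μ) {s : Set G}
    (hs : MeasurableSet s) (hμs : μ s ≠ ∞) :
    AEStronglyMeasurable (fun t => leftTranslate t g) (μ.restrict s) := by
  have hpos : ∀ n : ℕ, ((n : ℝ≥0∞) + 1)⁻¹ ≠ 0 := fun n =>
    ENNReal.inv_ne_zero.2 (by finiteness)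
  choose K hKs hK hKμ using fun n : ℕ => hs.exists_isCompact_sdiff_lt hμs (hpos n)
  have hU : (⋃ n, K n) =ᵐ[μ] s := by
    refine (Set.iUnion_subset hKs).eventuallyLE.antisymm (ae_le_set.2 (le_antisymm ?_ zero_le))
    have h : Tendsto (fun n : ℕ => ((n : ℝ≥0∞) + 1)⁻¹) atTop (𝓝 0) := by
      simpa using (tendsto_add_atTop_iff_nat 1).2 ENNReal.tendsto_inv_nat_nhds_zero
    refine ge_of_tendsto' h fun n => ?_
    exact (measure_mono (Set.sdiff_subset_sdiff_right (Set.subset_iUnion K n))).trans (hKμ n).le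
  rw [← Measure.restrict_congr_set hU, aestronglyMeasurable_iUnion_iff]
  exact fun n => (continuous_leftTranslate g).continuousOn.aestronglyMeasurable_of_isCompact
    (hK n) (hK n).measurableSet

theorem aestronglyMeasurable_smul_leftTranslate (f g : LOne μ) :
    AEStronglyMeasurable (fun t => f t • leftTranslate t g) μ := by
  have hf := L1.integrable_coeFn f
  obtain ⟨s, hs, hfs, hσ⟩ := hf.aefinStronglyMeasurable.exists_set_sigmaFinite
  have hg : AEStronglyMeasurable (fun t => leftTranslate t g) (μ.restrict s) := by
    have hU : (⋃ n, spanningSets (μ.restrict s) n ∩ s) = s := by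
      rw [← Set.iUnion_inter, iUnion_spanningSets, Set.univ_inter]
    rw [← hU, aestronglyMeasurable_iUnion_iff]
    intro n
    have hm := measurableSet_spanningSets (μ.restrict s) n
    refine aestronglyMeasurable_leftTranslate_restrict g (hm.inter hs) ?_
    rw [← Measure.restrict_apply hm]
    exact (measure_spanningSets_lt_top _ n).ne
  refine ((aestronglyMeasurable_indicator_iff hs).2
    (hf.aestronglyMeasurable.restrict.smul hg)).congr ?_
  filter_upwards [(ae_restrict_iff' hs.compl).1 hfs] with t ht
  by_cases hts : t ∈ s
  · simp [hts]
  · simp [hts, ht hts]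

theorem integrable_smul_leftTranslate (f g : LOne μ) :
    Integrable (fun t => f t • leftTranslate t g) μ := by
  refine ((L1.integrable_coeFn f).norm.mul_const ‖g‖).mono'
    (aestronglyMeasurable_smul_leftTranslate f g) (.of_forall fun t => ?_)
  rw [norm_smul, norm_leftTranslate]

/-- The convolution `f * g = ∫ f(t) (l_t g) dt`, that is, `(f * g)(x) = ∫ f(t) g(t⁻¹ x) dt`. -/
def conv (f g : LOne μ) : LOne μ := ∫ t, f t • leftTranslate t g ∂μ

theorem norm_conv_le (f g : LOne μ) : ‖conv f g‖ ≤ ‖f‖ * ‖g‖ := by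
  calc ‖conv f g‖ ≤ ∫ t, ‖f t • leftTranslate t g‖ ∂μ := norm_integral_le_integral_norm _
    _ = ∫ t, ‖f t‖ * ‖g‖ ∂μ := by simp only [norm_smul, norm_leftTranslate]
    _ = ‖f‖ * ‖g‖ := by rw [integral_mul_const, ← L1.norm_eq_integral_norm]

theorem conv_add_left (f₁ f₂ g : LOne μ) : conv (f₁ + f₂) g = conv f₁ g + conv f₂ g := by
  rw [conv, conv, conv, ← integral_add (integrable_smul_leftTranslate _ _)
    (integrable_smul_leftTranslate _ _)]
  refine integral_congr_ae ?_
  filter_upwards [Lp.coeFn_add f₁ f₂] with t ht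
  rw [ht, Pi.add_apply, add_smul]

theorem conv_smul_left (c : ℂ) (f g : LOne μ) : conv (c • f) g = c • conv f g := by
  rw [conv, conv, ← integral_smul]
  refine integral_congr_ae ?_
  filter_upwards [Lp.coeFn_smul c f] with t ht
  rw [ht, Pi.smul_apply, smul_assoc]

theorem conv_add_right (f g₁ g₂ : LOne μ) : conv f (g₁ + g₂) = conv f g₁ + conv f g₂ := by
  simp only [conv, leftTranslate_add, smul_add]
  exact integral_add (integrable_smul_leftTranslate _ _) (integrable_smul_leftTranslate _ _)

theorem conv_smul_right (c : ℂ) (f g : LOne μ) : conv f (c • g) = c • conv f g := by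
  simp only [conv, leftTranslate_smul]
  rw [← integral_smul]
  simp only [smul_comm c]

/-- Convolution as a bounded bilinear map. -/
def convL : LOne μ →L[ℂ] LOne μ →L[ℂ] LOne μ :=
  LinearMap.mkContinuous₂
    (LinearMap.mk₂ ℂ conv conv_add_left conv_smul_left conv_add_right conv_smul_right) 1
    (fun f g => by simpa using norm_conv_le f g)

theorem convL_apply (f g : LOne μ) : convL f g = conv f g := rfl

/-- The element `f T` of `L_∞(G)`, given by `⟨f T, g⟩ = ⟨T, f * g⟩`. -/
def leftAct (f : LOne μ) (T : LInfty μ) : LInfty μ := T.comp (convL f)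

/-- The element `T f` of `L_∞(G)`, given by `⟨T f, g⟩ = ⟨T, g * f⟩`. -/
def rightAct (T : LInfty μ) (f : LOne μ) : LInfty μ := T.comp (convL.flip f)

theorem leftAct_apply (f g : LOne μ) (T : LInfty μ) : leftAct f T g = T (conv f g) := rfl

theorem rightAct_apply (f g : LOne μ) (T : LInfty μ) : rightAct T f g = T (conv g f) := rfl

/-- Topological left invariance of a functional on `L_∞(G)`. -/
def IsTopLeftInvariant (m : StrongDual ℂ (LInfty μ)) : Prop :=
  ∀ f ∈ P1 μ, ∀ T : LInfty μ, m (leftAct f T) = m T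

/-- Topological right invariance of a functional on `L_∞(G)`. -/
def IsTopRightInvariant (m : StrongDual ℂ (LInfty μ)) : Prop :=
  ∀ f ∈ P1 μ, ∀ T : LInfty μ, m (rightAct T f) = m T

/-- A net in `P_1(G)` with `‖g * f_γ - f_γ‖₁ → 0` for every `g` in `P_1(G)`. -/
def IsLeftTINet {Γ : Type*} [Preorder Γ] (f : Γ → LOne μ) : Prop :=
  (∀ γ, f γ ∈ P1 μ) ∧ ∀ g ∈ P1 μ, Tendsto (fun γ => ‖conv g (f γ) - f γ‖) atTop (𝓝 0)

/-- A net in `P_1(G)` with `‖f_γ * g - f_γ‖₁ → 0` for every `g` in `P_1(G)`. -/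
def IsRightTINet {Γ : Type*} [Preorder Γ] (f : Γ → LOne μ) : Prop :=
  (∀ γ, f γ ∈ P1 μ) ∧ ∀ g ∈ P1 μ, Tendsto (fun γ => ‖conv (f γ) g - f γ‖) atTop (𝓝 0)

end Convolution

end TopInvMean

end

noncomputable section

namespace TopInvMean

section Mean

variable {G : Type*} [MeasurableSpace G] {μ : Measure G}

/-! A mean cannot exceed the supremum of `Re (T f)` over `P1 μ` (`IsMean.re_le`), so Hahn-Banach
approximates it weak* by elements of `P1 μ`. To get norm rather than weak asymptotic invariance,
finitely many pairings `T f` and vectors `L f` are collected into one operator `Φ` with values in a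
normed space. The image of `P1 μ` is convex, so a point outside its norm closure is separated by a
functional `ψ`; but `ψ.comp Φ` lies in `L_∞`, where the mean gives a contradiction. With `L` a
convolution operator minus the identity, invariance of `m` says that `m` kills every `T.comp L`. One
net handles all such `L` at once, hence all three cases. -/

theorem LOne.IsNonneg.unit_apply_eq_norm {f : LOne μ} (hf : f.IsNonneg) :
    LInfty.unit μ f = (‖f‖ : ℂ) := by
  rw [LInfty.unit_apply, L1.norm_eq_integral_norm, ← integral_complex_ofReal]
  refine integral_congr_ae ?_
  filter_upwards [hf] with x hx
  simpa using Complex.eq_coe_norm_of_nonneg hx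

/-- On nonnegative functions the norm is the linear functional `LInfty.unit`, hence additive. -/
theorem convex_P1 : Convex ℝ (P1 μ) := by
  intro f hf g hg a b ha hb hab
  have h : LOne.IsNonneg (a • f + b • g) := by
    filter_upwards [hf.1, hg.1, Lp.coeFn_add (a • f) (b • g), Lp.coeFn_smul a f,
      Lp.coeFn_smul b g] with x hfx hgx h₁ h₂ h₃
    rw [h₁, Pi.add_apply, h₂, h₃, Pi.smul_apply, Pi.smul_apply]
    exact add_nonneg (smul_nonneg ha hfx) (smul_nonneg hb hgx)
  refine ⟨h, ?_⟩
  have key := h.unit_apply_eq_norm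
  rw [map_add, LinearMapClass.map_smul_of_tower, LinearMapClass.map_smul_of_tower,
    hf.1.unit_apply_eq_norm, hg.1.unit_apply_eq_norm, hf.2, hg.2] at key
  simp only [Complex.ofReal_one, Complex.real_smul, mul_one] at key
  rw [← Complex.ofReal_add, hab] at key
  exact_mod_cast key.symm

/-- Pointwise complex conjugation on `L_1(G)`. -/
def LOne.conj : LOne μ →L⋆[ℂ] LOne μ :=
  ((starL ℂ : ℂ ≃L⋆[ℂ] ℂ) : ℂ →L⋆[ℂ] ℂ).compLpL 1 μ

theorem LOne.IsNonneg.conj_eq {f : LOne μ} (hf : f.IsNonneg) : LOne.conj f = f := by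
  refine Lp.ext ?_
  filter_upwards [hf, ContinuousLinearMap.coeFn_compLpL
    ((starL ℂ : ℂ ≃L⋆[ℂ] ℂ) : ℂ →L⋆[ℂ] ℂ) f] with x hx h
  refine h.trans ?_
  exact Complex.conj_eq_iff_im.2 (Complex.nonneg_iff.1 hx).2.symm

/-- The conjugate `f ↦ conj (T (conj f))` of an element `T` of `L_∞(G)`. -/
def LInfty.conj (T : LInfty μ) : LInfty μ :=
  (((starL ℂ : ℂ ≃L⋆[ℂ] ℂ) : ℂ →L⋆[ℂ] ℂ).comp T).comp LOne.conj

theorem LInfty.conj_apply {f : LOne μ} (hf : f.IsNonneg) (T : LInfty μ) :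
    T.conj f = (starRingEnd ℂ) (T f) := by
  change (starRingEnd ℂ) (T (LOne.conj f)) = _
  rw [hf.conj_eq]

variable {m : StrongDual ℂ (LInfty μ)}

/-- For such `T`, the element `‖T‖ • 1 - T` is positive, so its mean is real. -/
theorem IsMean.im_eq_zero (hm : IsMean m) {T : LInfty μ}
    (hT : ∀ f : LOne μ, f.IsNonneg → (T f).im = 0) : (m T).im = 0 := by
  have h := hm.nonneg ((‖T‖ : ℂ) • LInfty.unit μ - T) fun f hf => by
    rw [_root_.sub_apply, _root_.smul_apply, hf.unit_apply_eq_norm,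
      Complex.nonneg_iff]
    have := (Complex.re_le_norm (T f)).trans (T.le_opNorm f)
    simp [hT f hf, this]
  simpa [hm.map_unit] using (Complex.nonneg_iff.1 h).2

/-- Both `T + T.conj` and `I • (T - T.conj)` are real, so their means are; this fixes the imaginary
and real parts of `m T.conj`. -/
theorem IsMean.apply_conj (hm : IsMean m) (T : LInfty μ) :
    m T.conj = (starRingEnd ℂ) (m T) := by
  have h₁ := hm.im_eq_zero (T := T + T.conj) fun f hf => by
    simp [LInfty.conj_apply hf]
  have h₂ := hm.im_eq_zero (T := Complex.I • (T - T.conj)) fun f hf => by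
    simp [LInfty.conj_apply hf]
  simp only [map_add, map_sub, map_smul, Complex.add_im, smul_eq_mul, Complex.I_mul_im,
    Complex.sub_re] at h₁ h₂
  apply Complex.ext <;> simp <;> linarith

/-- A real upper bound over `P_1(G)` is an upper bound for the mean. -/
theorem IsMean.re_le (hm : IsMean m) {T : LInfty μ} {s : ℝ} (hT : ∀ f ∈ P1 μ, (T f).re ≤ s) :
    (m T).re ≤ s := by
  have hT' : ∀ f : LOne μ, f.IsNonneg → (T f).re ≤ s * ‖f‖ := by
    intro f hf
    rcases eq_or_ne f 0 with rfl | h0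
    · simp
    have hn : 0 < ‖f‖ := norm_pos_iff.2 h0
    have hmem : ‖f‖⁻¹ • f ∈ P1 μ := by
      refine ⟨?_, by rw [norm_smul, norm_inv, norm_norm, inv_mul_cancel₀ hn.ne']⟩
      filter_upwards [hf, Lp.coeFn_smul ‖f‖⁻¹ f] with x hx h
      rw [h]
      exact smul_nonneg (inv_nonneg.2 hn.le) hx
    have h := hT _ hmem
    rw [LinearMapClass.map_smul_of_tower, Complex.smul_re, smul_eq_mul,
      inv_mul_le_iff₀ hn] at h
    linarith
  -- Positivity only tests real elements, so `T` is replaced by `T + T.conj`, twice its real part.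
  have h := hm.nonneg (((2 * s : ℝ) : ℂ) • LInfty.unit μ - (T + T.conj)) fun f hf => by
    rw [_root_.sub_apply, _root_.smul_apply, hf.unit_apply_eq_norm,
      _root_.add_apply, LInfty.conj_apply hf, Complex.nonneg_iff]
    have := hT' f hf
    constructor
    · simp only [smul_eq_mul, Complex.sub_re, Complex.add_re, Complex.conj_re,
        Complex.re_ofReal_mul, Complex.ofReal_re]
      linarith
    · simp
  have h' := (Complex.nonneg_iff.1 h).1
  simp only [map_sub, map_smul, map_add, hm.map_unit, hm.apply_conj, smul_eq_mul, mul_one,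
    Complex.sub_re, Complex.add_re, Complex.conj_re, Complex.ofReal_re] at h'
  linarith

/-- If a bounded operator `Φ` into `V` satisfies `m (ψ ∘ Φ) = ψ p` for every functional `ψ`, then
`p` is a limit of values of `Φ` on `P_1(G)`. -/
theorem IsMean.mem_closure_image_P1 (hm : IsMean m) {V : Type*} [NormedAddCommGroup V]
    [NormedSpace ℂ V] (Φ : LOne μ →L[ℂ] V) (p : V)
    (hp : ∀ ψ : StrongDual ℂ V, m (ψ.comp Φ) = ψ p) : p ∈ closure (Φ '' P1 μ) := by
  by_contra hnot
  have hconv : Convex ℝ (closure (Φ '' P1 μ)) :=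
    (convex_P1.linear_image (Φ.restrictScalars ℝ : LOne μ →ₗ[ℝ] V)).closure
  obtain ⟨ψ, s, hs, hps⟩ :=
    RCLike.geometric_hahn_banach_closed_point (𝕜 := ℂ) hconv isClosed_closure hnot
  have h := hm.re_le (T := ψ.comp Φ) (s := s) fun f hf =>
    (hs _ (subset_closure ⟨f, hf, rfl⟩)).le
  rw [hp] at h
  exact hps.not_ge h

/-- The bounded operators on `L_1(G)` whose adjoint maps `L_∞(G)` into the kernel of `m`. -/
def annihilatedOperators (m : StrongDual ℂ (LInfty μ)) : Set (LOne μ →L[ℂ] LOne μ) :=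
  {L | ∀ T : LInfty μ, m (T.comp L) = 0}

/-- The target point has coordinates `m T` for `T ∈ F` and `0` for `L ∈ K`; the sup norm on the
product bounds every coordinate at once. -/
theorem IsMean.exists_mem_P1_forall_lt (hm : IsMean m) (F : Finset (LInfty μ))
    (K : Finset (annihilatedOperators m)) {ε : ℝ} (hε : 0 < ε) :
    ∃ f ∈ P1 μ, (∀ T ∈ F, ‖T f - m T‖ < ε) ∧ ∀ L ∈ K, ‖L.1 f‖ < ε := by
  classical
  let Φ : LOne μ →L[ℂ] (F → ℂ) × (K → LOne μ) :=
    (ContinuousLinearMap.pi fun T : F => T.1).prod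
      (ContinuousLinearMap.pi fun L : K => L.1.1)
  let p : (F → ℂ) × (K → LOne μ) := (fun T => m T.1, 0)
  have hp : p ∈ closure (Φ '' P1 μ) := by
    refine hm.mem_closure_image_P1 Φ p fun ψ => ?_
    -- Splitting `ψ` along coordinates writes `ψ.comp Φ` as a combination of the `T ∈ F` plus terms
    -- `φ.comp L`, which `m` kills.
    have h₁ : ∀ x y, ψ (x, y) = (∑ T, x T * ψ (Pi.single T 1, 0))
        + ∑ L, ψ (0, Pi.single L (y L)) := by
      intro x y
      have hxy : (x, y) = ContinuousLinearMap.inl ℂ _ _ x + ContinuousLinearMap.inr ℂ _ _ y := by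
        simp
      rw [hxy, map_add]
      congr 1
      · conv_lhs => rw [pi_eq_sum_univ' x]
        rw [map_sum, map_sum]
        refine Finset.sum_congr rfl fun T _ => ?_
        rw [map_smul, map_smul, smul_eq_mul, ContinuousLinearMap.inl_apply]
      · conv_lhs => rw [← Finset.univ_sum_single y]
        rw [map_sum, map_sum]
        rfl
    have h₂ : ψ.comp Φ = (∑ T : F, ψ (Pi.single T 1, 0) • T.1)
        + ∑ L : K, ((ψ.comp (ContinuousLinearMap.inr ℂ _ _)).comp
          (ContinuousLinearMap.single ℂ (fun _ : K => LOne μ) L)).comp L.1.1 := by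
      ext f
      simp only [_root_.add_apply, _root_.sum_apply,
        _root_.smul_apply, smul_eq_mul]
      refine (h₁ _ _).trans ?_
      congr 1
      exact Finset.sum_congr rfl fun T _ => mul_comm _ _
    have h₃ : ∀ (L : K) (T : LInfty μ), m (T.comp L.1.1) = 0 := fun L T => L.1.2 T
    rw [h₂, map_add, map_sum, map_sum, h₁]
    simp only [h₃, map_smul, smul_eq_mul, Pi.zero_apply, Pi.single_zero, Finset.sum_const_zero,
      add_zero, Prod.mk_zero_zero, map_zero]
    exact Finset.sum_congr rfl fun T _ => mul_comm _ _
  obtain ⟨_, ⟨f, hf, rfl⟩, hd⟩ := Metric.mem_closure_iff.1 hp ε hε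
  rw [dist_comm, dist_eq_norm] at hd
  refine ⟨f, hf, fun T hT => ?_, fun L hL => ?_⟩
  · exact (norm_le_pi_norm ((Φ f - p).1) ⟨T, hT⟩).trans_lt ((norm_fst_le _).trans_lt hd)
  · have h := (norm_le_pi_norm ((Φ f - p).2) ⟨L, hL⟩).trans_lt ((norm_snd_le _).trans_lt hd)
    have he : (Φ f - p).2 ⟨L, hL⟩ = L.1 f := sub_zero _
    rwa [he] at h

/-- Every mean is the weak* limit of a net in `P_1(G)` on which all the operators annihilated by
the mean tend to zero in norm. -/
theorem IsMean.exists_net {G : Type u} [MeasurableSpace G] {μ : Measure G}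
    {m : StrongDual ℂ (LInfty μ)} (hm : IsMean m) :
    ∃ (Γ : Type u) (_ : Preorder Γ) (_ : IsDirectedOrder Γ) (_ : Nonempty Γ) (f : Γ → LOne μ),
      (∀ γ, f γ ∈ P1 μ) ∧
      (∀ L ∈ annihilatedOperators m, Tendsto (fun γ => ‖L (f γ)‖) atTop (𝓝 0)) ∧
      WeakStarTendsto f m := by
  classical
  -- The index records which `T` and `L` are controlled, with tolerance `1 / (n + 1)`.
  choose f hf hfF hfK using fun γ : Finset (LInfty μ) × Finset (annihilatedOperators m) × ℕ =>
    hm.exists_mem_P1_forall_lt γ.1 γ.2.1 (Nat.one_div_pos_of_nat (α := ℝ) (n := γ.2.2))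
  refine ⟨Finset (LInfty μ) × Finset (annihilatedOperators m) × ℕ, inferInstance, inferInstance,
    inferInstance, f, hf, fun L hL => ?_, fun T => ?_⟩
  · rw [Metric.tendsto_atTop]
    intro ε hε
    obtain ⟨n, hn⟩ := exists_nat_one_div_lt hε
    refine ⟨(∅, {⟨L, hL⟩}, n), fun γ hγ => ?_⟩
    rw [dist_zero_right, norm_norm]
    exact (hfK γ ⟨L, hL⟩ (hγ.2.1 (Finset.mem_singleton_self _))).trans
      ((Nat.one_div_le_one_div hγ.2.2).trans_lt hn)
  · rw [Metric.tendsto_atTop]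
    intro ε hε
    obtain ⟨n, hn⟩ := exists_nat_one_div_lt hε
    refine ⟨({T}, ∅, n), fun γ hγ => ?_⟩
    rw [dist_eq_norm]
    exact (hfF γ T (hγ.1 (Finset.mem_singleton_self _))).trans
      ((Nat.one_div_le_one_div hγ.2.2).trans_lt hn)

end Mean

/-! ### Convolution operators and invariant means -/

section Invariance

variable {G : Type*} [Group G] [TopologicalSpace G] [IsTopologicalGroup G] [LocallyCompactSpace G]
  [T2Space G] [MeasurableSpace G] [BorelSpace G] {μ : Measure G} [μ.IsHaarMeasure] [μ.Regular]
  {m : StrongDual ℂ (LInfty μ)}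

theorem IsTopLeftInvariant.convL_sub_id_mem (hm : IsTopLeftInvariant m) {g : LOne μ}
    (hg : g ∈ P1 μ) : convL g - ContinuousLinearMap.id ℂ (LOne μ) ∈ annihilatedOperators m := by
  intro T
  rw [ContinuousLinearMap.comp_sub, ContinuousLinearMap.comp_id, map_sub, sub_eq_zero]
  exact hm g hg T

theorem IsTopRightInvariant.convL_flip_sub_id_mem (hm : IsTopRightInvariant m) {g : LOne μ}
    (hg : g ∈ P1 μ) :
    convL.flip g - ContinuousLinearMap.id ℂ (LOne μ) ∈ annihilatedOperators m := by
  intro T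
  rw [ContinuousLinearMap.comp_sub, ContinuousLinearMap.comp_id, map_sub, sub_eq_zero]
  exact hm g hg T

theorem IsTopLeftInvariant.isLeftTINet (hm : IsTopLeftInvariant m) {Γ : Type*} [Preorder Γ]
    {f : Γ → LOne μ} (hf : ∀ γ, f γ ∈ P1 μ)
    (hL : ∀ L ∈ annihilatedOperators m, Tendsto (fun γ => ‖L (f γ)‖) atTop (𝓝 0)) :
    IsLeftTINet f := by
  refine ⟨hf, fun g hg => ?_⟩
  have h := hL _ (hm.convL_sub_id_mem hg)
  simpa only [_root_.sub_apply, convL_apply, ContinuousLinearMap.id_apply] using h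

theorem IsTopRightInvariant.isRightTINet (hm : IsTopRightInvariant m) {Γ : Type*} [Preorder Γ]
    {f : Γ → LOne μ} (hf : ∀ γ, f γ ∈ P1 μ)
    (hL : ∀ L ∈ annihilatedOperators m, Tendsto (fun γ => ‖L (f γ)‖) atTop (𝓝 0)) :
    IsRightTINet f := by
  refine ⟨hf, fun g hg => ?_⟩
  have h := hL _ (hm.convL_flip_sub_id_mem hg)
  simpa only [_root_.sub_apply, ContinuousLinearMap.flip_apply, convL_apply,
    ContinuousLinearMap.id_apply] using h

end Invariance

end TopInvMean

end

theorem mainTheorem8 {G : Type u} [Group G] [TopologicalSpace G] [IsTopologicalGroup G]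
    [LocallyCompactSpace G] [T2Space G] [MeasurableSpace G] [BorelSpace G]
    (μ : Measure G) [μ.IsHaarMeasure] [μ.Regular]
    (m : StrongDual ℂ (TopInvMean.LInfty μ)) (hm : TopInvMean.IsMean m) :
    (TopInvMean.IsTopLeftInvariant m →
      ∃ (Γ : Type u) (_ : Preorder Γ) (_ : IsDirectedOrder Γ) (_ : Nonempty Γ)
        (f : Γ → TopInvMean.LOne μ),
        TopInvMean.IsLeftTINet f ∧ TopInvMean.WeakStarTendsto f m) ∧
    (TopInvMean.IsTopRightInvariant m →
      ∃ (Γ : Type u) (_ : Preorder Γ) (_ : IsDirectedOrder Γ) (_ : Nonempty Γ)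
        (f : Γ → TopInvMean.LOne μ),
        TopInvMean.IsRightTINet f ∧ TopInvMean.WeakStarTendsto f m) ∧
    (TopInvMean.IsTopLeftInvariant m ∧ TopInvMean.IsTopRightInvariant m →
      ∃ (Γ : Type u) (_ : Preorder Γ) (_ : IsDirectedOrder Γ) (_ : Nonempty Γ)
        (f : Γ → TopInvMean.LOne μ),
        (TopInvMean.IsLeftTINet f ∧ TopInvMean.IsRightTINet f) ∧
          TopInvMean.WeakStarTendsto f m) := by

  obtain ⟨Γ, hΓ, hdir, hne, f, hf, hL, hw⟩ := hm.exists_net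
  have left (h : TopInvMean.IsTopLeftInvariant m) : TopInvMean.IsLeftTINet f :=
    h.isLeftTINet hf hL
  have right (h : TopInvMean.IsTopRightInvariant m) : TopInvMean.IsRightTINet f :=
    h.isRightTINet hf hL
  exact ⟨fun h => ⟨Γ, hΓ, hdir, hne, f, left h, hw⟩,
    fun h => ⟨Γ, hΓ, hdir, hne, f, right h, hw⟩,
    fun h => ⟨Γ, hΓ, hdir, hne, f, ⟨left h.1, right h.2⟩, hw⟩⟩
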